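/- There is an integer $n_0$ such that the following holds for every $n \ge n_0$ and every real number $t \ge 2$ (which may depend on $n$). Let $G=(V,E)$ be a finite simple graph with $|V|=n$ such that for all disjoint subsets $A,B \subseteq V$ with $|A|,|B| \ge n/t$ there is an edge of $G$ between a vertex of $A$ and a vertex of $B$. Then $G$ contains a cycle of length exactly $k$ for every integer $k \ge 3$ with $$\frac{8\, n \log n}{t \log\log n} \;\le\; k \;\le\; n - \frac{3n}{t},$$ where $\log$ denotes the natural logarithm. -/

import Mathlib

/-! With `s = ⌈n / t⌉` the graph is `s`-joined, and for `s ≥ 1` this alone gives all cycle lengths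
from `40 * s` to `|V| - 2 * s + 2`; the logarithms only have to beat a constant. A cycle is built
from two disjoint paths that end at the two vertices of an edge. Rotations keep the vertex set and
the end of each path while its first vertex ranges over at least `s` vertices, so some edge joins a
first vertex of one to a first vertex of the other and closes the cycle. There are that many because
a small set of first vertices would have few neighbours by Pósa's lemma (`exists_rotation_ends`),
against the expansion left by `exists_expanding`. The exact length comes from
`exists_ends_of_length`, which trims first vertices lying outside a fixed expanding core. -/

/-- Two disjoint vertex sets of size at least `s` are always joined by an edge. -/
def SimpleGraph.IsJoined {V : Type*} (G : SimpleGraph V) (s : ℕ) : Prop :=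
  ∀ A B : Finset V, Disjoint A B → s ≤ A.card → s ≤ B.card → ∃ a ∈ A, ∃ b ∈ B, G.Adj a b

/-- The list `l` is a path of `G` inside `W` whose last vertex is `r`. -/
structure SimpleGraph.IsListPath {V : Type*} (G : SimpleGraph V) (W : Finset V) (r : V)
    (l : List V) : Prop where
  chain : l.IsChain G.Adj
  nodup : l.Nodup
  last : l.getLast? = some r
  mem : ∀ x ∈ l, x ∈ W

/-- `l'` arises from `l` by reversing an initial segment `a`, the edge from the first vertex
of `l` to the first vertex after `a` replacing the edge that leaves `a`. -/
def SimpleGraph.IsRotation {V : Type*} (G : SimpleGraph V) (l l' : List V) : Prop :=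
  ∃ (v : V) (a : List V) (x : V) (b : List V),
    l = (v :: a) ++ (x :: b) ∧ G.Adj v x ∧ l' = (v :: a).reverse ++ (x :: b)

namespace SimpleGraph

variable {V : Type*} {G : SimpleGraph V} {W : Finset V} {r : V} {l l' : List V}

/-! ### Rotations of a path -/

/-- The relation is arbitrary so as to serve both adjacency and the invariant in `rotations_adj`. -/
lemma IsRotation.chain {R : V → V → Prop} (hR : ∀ x y, R x y → R y x) {v x : V} {a b : List V}
    (h : ((v :: a) ++ (x :: b)).IsChain R) (hvx : R v x) :
    ((v :: a).reverse ++ (x :: b)).IsChain R := by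
  rw [List.isChain_append] at h ⊢
  obtain ⟨h1, h2, -⟩ := h
  refine ⟨?_, h2, ?_⟩
  · rw [List.isChain_reverse]
    exact h1.imp fun _ _ h => hR _ _ h
  · intro y hy z hz
    simp at hy hz
    subst hy hz
    exact hvx

lemma IsRotation.perm (h : G.IsRotation l l') : l'.Perm l := by
  obtain ⟨v, a, x, b, rfl, -, rfl⟩ := h
  exact (List.reverse_perm _).append_right _

lemma IsRotation.isListPath (h : G.IsRotation l l') (hl : G.IsListPath W r l) :
    G.IsListPath W r l' := by
  have hp := h.perm
  obtain ⟨v, a, x, b, rfl, hvx, rfl⟩ := h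
  refine ⟨IsRotation.chain (fun _ _ h => h.symm) hl.chain hvx, hp.nodup_iff.2 hl.nodup, ?_,
    fun y hy => hl.mem y (hp.mem_iff.1 hy)⟩
  rw [← hl.last, List.getLast?_append_of_ne_nil _ (List.cons_ne_nil x b),
    List.getLast?_append_of_ne_nil _ (List.cons_ne_nil x b)]

lemma perm_of_rotations (h : Relation.ReflTransGen G.IsRotation l l') : l'.Perm l := by
  induction h with
  | refl => exact List.Perm.refl _
  | tail _ h ih => exact h.perm.trans ih

lemma isListPath_of_rotations (h : Relation.ReflTransGen G.IsRotation l l')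
    (hl : G.IsListPath W r l) : G.IsListPath W r l' := by
  induction h with
  | refl => exact hl
  | tail _ h ih => exact h.isListPath ih

/-! ### Pósa's lemma -/

/-- The consecutive pairs of a list without repetitions are described by a successor function
and a predecessor function. -/
lemma exists_succ_pred_of_nodup [Nonempty V] {l : List V} (hl : l.Nodup) :
    ∃ f g : V → V, l.IsChain fun x y => f x = y ∧ g y = x := by
  classical
  obtain ⟨d⟩ := ‹Nonempty V›
  -- The default `d` and the truncated `0 - 1` only concern the ends of the list and vertices off
  -- it, where nothing is claimed.
  refine ⟨fun x => l.getD (l.idxOf x + 1) d, fun x => l.getD (l.idxOf x - 1) d, ?_⟩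
  rw [List.isChain_iff_getElem]
  intro i hi
  constructor
  · simp [hl.idxOf_getElem, List.getD, hi]
  · simp [hl.idxOf_getElem, List.getD, Nat.lt_of_succ_lt hi]

/-- A vertex adjacent to an end of a rotation is itself such an end, or it is next to one
on the initial path. -/
lemma rotations_adj {f g : V → V} (hfg : l.IsChain fun x y => f x = y ∧ g y = x)
    {S : Set V}
    (hS : ∀ v, v ∈ S ↔ ∃ l', Relation.ReflTransGen G.IsRotation l l' ∧ l'.head? = some v)
    {u v : V} (hv : v ∈ S) (huv : G.Adj v u) (hul : u ∈ l) :
    u ∈ S ∨ (∃ w ∈ S, f w = u) ∨ ∃ w ∈ S, g w = u := by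
  by_contra hcon
  push Not at hcon
  obtain ⟨huS, hf, hg⟩ := hcon
  let E : V → V → Prop := fun x y => (f x = y ∧ g y = x) ∨ (f y = x ∧ g x = y)
  have hEu : ∀ w ∈ S, ¬ E u w := by
    rintro w hw (h | h)
    · exact hg w hw h.2
    · exact hf w hw h.1
  -- Invariant: in every rotated path, the path neighbours of `u` are among its initial ones.
  let R : V → V → Prop := fun x y => (x = u → E u y) ∧ (y = u → E u x)
  have hRsymm : ∀ x y, R x y → R y x := fun x y h => ⟨h.2, h.1⟩
  have key : ∀ l', Relation.ReflTransGen G.IsRotation l l' → l'.IsChain R := by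
    intro l' h
    induction h with
    | refl =>
      refine hfg.imp fun x y h => ⟨?_, ?_⟩
      · rintro rfl; exact Or.inl h
      · rintro rfl; exact Or.inr h
    | @tail l₁ l₂ h₁ h₂ ih =>
      have hl₂ := h₁.tail h₂
      obtain ⟨w, a, x, b, rfl, hwx, rfl⟩ := h₂
      have hwS : w ∈ S := (hS w).2 ⟨_, h₁, by simp⟩
      refine IsRotation.chain hRsymm ih ⟨fun h => (huS (h ▸ hwS)).elim, ?_⟩
      -- Pivoting at `u` would turn the vertex before it, an initial neighbour of `u`, into an end.
      rintro rfl
      exfalso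
      obtain ⟨z, hz⟩ : ∃ z, (w :: a).getLast? = some z :=
        ⟨_, List.getLast?_eq_some_getLast (List.cons_ne_nil w a)⟩
      have hzS : z ∈ S := (hS z).2 ⟨_, hl₂, by
        rw [List.head?_append, List.head?_reverse, hz]; rfl⟩
      rw [List.isChain_append] at ih
      exact hEu z hzS ((ih.2.2 z hz x (by simp)).2 rfl)
  obtain ⟨l', hl', hhead⟩ := (hS v).1 hv
  have hul' : u ∈ l' := (perm_of_rotations hl').mem_iff.2 hul
  obtain ⟨a, b, rfl⟩ := List.append_of_mem hul'
  have hch := key _ hl'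
  cases a with
  | nil =>
    simp at hhead
    exact huS (hhead ▸ hv)
  | cons w a =>
    simp at hhead
    subst hhead
    obtain ⟨z, hz⟩ : ∃ z, (w :: a).getLast? = some z :=
        ⟨_, List.getLast?_eq_some_getLast (List.cons_ne_nil w a)⟩
    have hzS : z ∈ S := (hS z).2 ⟨(w :: a).reverse ++ (u :: b),
      hl'.tail ⟨w, a, u, b, rfl, huv, rfl⟩, by
        rw [List.head?_append, List.head?_reverse, hz]; rfl⟩
    rw [List.isChain_append] at hch
    exact hEu z hzS ((hch.2.2 z hz u (by simp)).2 rfl)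

/-- Pósa's lemma: the ends of the rotations of a longest path have few neighbours, all of them
on the path. -/
lemma exists_rotation_ends [DecidableEq V] (hl : G.IsListPath W r l)
    (hmax : ∀ l', G.IsListPath W r l' → l'.length ≤ l.length) :
    ∃ S : Finset V, S.Nonempty ∧
      (∀ v ∈ S, ∃ l', G.IsListPath W r l' ∧ l'.Perm l ∧ l'.head? = some v) ∧
      S ⊆ l.toFinset ∧ (∀ v ∈ S, ∀ u ∈ W, G.Adj v u → u ∈ l.toFinset) ∧
      ∃ N : Finset V, N.card ≤ 2 * S.card ∧ ∀ v ∈ S, ∀ u ∈ W, G.Adj v u → u ∈ S ∪ N := by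
  classical
  have : Nonempty V := ⟨r⟩
  obtain ⟨f, g, hfg⟩ := exists_succ_pred_of_nodup hl.nodup
  let S : Finset V := l.toFinset.filter fun v =>
    ∃ l', Relation.ReflTransGen G.IsRotation l l' ∧ l'.head? = some v
  have hS : ∀ v, v ∈ (S : Set V) ↔
      ∃ l', Relation.ReflTransGen G.IsRotation l l' ∧ l'.head? = some v := by
    intro v
    simp only [S, Finset.coe_filter, List.mem_toFinset, Set.mem_ofPred_eq, and_iff_right_iff_imp]
    rintro ⟨l', h, hv⟩
    exact (perm_of_rotations h).mem_iff.1 (List.mem_of_head? hv)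
  have hadj : ∀ v ∈ S, ∀ u ∈ W, G.Adj v u → u ∈ l.toFinset := by
    intro v hv u hu hvu
    obtain ⟨l', h, hhead⟩ := (hS v).1 hv
    by_contra hul
    have hp := perm_of_rotations h
    have hl' := isListPath_of_rotations h hl
    have hul' : u ∉ l' := fun h' => hul (List.mem_toFinset.2 (hp.mem_iff.1 h'))
    have := hmax (u :: l') ⟨?_, List.nodup_cons.2 ⟨hul', hl'.nodup⟩, ?_, ?_⟩
    · simp [hp.length_eq] at this
    · rw [List.isChain_cons]
      refine ⟨fun y hy => ?_, hl'.chain⟩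
      rw [hhead] at hy
      simp at hy
      exact hy ▸ hvu.symm
    · simp [List.getLast?_cons, hl'.last]
    · simpa [hu] using hl'.mem
  refine ⟨S, ?_, ?_, Finset.filter_subset _ _, hadj, S.image f ∪ S.image g, ?_, ?_⟩
  · cases hl0 : l with
    | nil => have := hl.last; simp [hl0] at this
    | cons v t => exact ⟨v, (hS v).2 ⟨l, .refl, by simp [hl0]⟩⟩
  · intro v hv
    obtain ⟨l', h, hhead⟩ := (hS v).1 hv
    exact ⟨l', isListPath_of_rotations h hl, perm_of_rotations h, hhead⟩
  · calc _ ≤ _ := Finset.card_union_le _ _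
      _ ≤ S.card + S.card := add_le_add Finset.card_image_le Finset.card_image_le
      _ = _ := by ring
  · intro v hv u hu hvu
    have := rotations_adj hfg hS hv hvu (List.mem_toFinset.1 (hadj v hv u hu hvu))
    simp only [Finset.mem_union, Finset.mem_image]
    simpa using this

/-! ### Expansion and longest paths -/

/-- In a joined graph, after the deletion of fewer than `s` vertices every small set of vertices
expands into what is left of a given set `K` of size `9 * s`. -/
lemma IsJoined.exists_expanding [Fintype V] [DecidableEq V] {s : ℕ} (hG : G.IsJoined s)
    (hs : 1 ≤ s) {K : Finset V} (hK : 9 * s ≤ K.card) :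
    ∃ Z : Finset V, Z.card < s ∧ ∀ X N : Finset V, Disjoint X Z → X.Nonempty → X.card ≤ s →
      (∀ v ∈ X, ∀ u ∈ K \ Z, G.Adj v u → u ∈ X ∪ N) → 3 * X.card < N.card := by
  classical
  -- a set of size between `s` and `2 * s` has many neighbours in `K`
  have hbig : ∀ X N : Finset V, s ≤ X.card → X.card ≤ 2 * s → N.card ≤ 3 * X.card →
      (∀ v ∈ X, ∀ u ∈ K, G.Adj v u → u ∈ X ∪ N) → False := by
    intro X N h1 h2 h3 h4
    -- `9 * s - 2 * s - 3 * (2 * s) = s`.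
    have hc : s ≤ (K \ (X ∪ N)).card := by
      have := Finset.le_card_sdiff (X ∪ N) K
      have := Finset.card_union_le X N
      omega
    obtain ⟨a, ha, b, hb, hab⟩ := hG X (K \ (X ∪ N))
      (Finset.disjoint_left.2 fun x hx hx' =>
        (Finset.mem_sdiff.1 hx').2 (Finset.mem_union_left _ hx)) h1 hc
    exact (Finset.mem_sdiff.1 hb).2 (h4 a ha b (Finset.mem_sdiff.1 hb).1 hab)
  let P : Finset V → Prop := fun X => X.card ≤ s ∧ ∃ N : Finset V, N.card ≤ 3 * X.card ∧
    ∀ v ∈ X, ∀ u ∈ K, G.Adj v u → u ∈ X ∪ N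
  -- Delete a largest non-expanding set. Another one outside it would give a union that is either
  -- larger of the same kind or of a size excluded by `hbig`.
  obtain ⟨Z, hZ, hmax⟩ := Finset.exists_max_image (Finset.univ.filter P) Finset.card
    ⟨∅, by simp [P]⟩
  simp only [Finset.mem_filter, Finset.mem_univ, true_and] at hZ hmax
  obtain ⟨hZs, N₀, hN₀, hZN⟩ := hZ
  refine ⟨Z, lt_of_not_ge fun h => hbig Z N₀ h (by omega) hN₀ hZN, ?_⟩
  intro X N hXZ hX hXs hXN
  by_contra! hN
  have hcard : (X ∪ Z).card = X.card + Z.card := Finset.card_union_of_disjoint hXZ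
  have hpos := hX.card_pos
  have hN' : (N ∪ N₀).card ≤ 3 * (X ∪ Z).card := by
    have := Finset.card_union_le N N₀
    omega
  have hnb : ∀ v ∈ X ∪ Z, ∀ u ∈ K, G.Adj v u → u ∈ (X ∪ Z) ∪ (N ∪ N₀) := by
    intro v hv u hu hvu
    by_cases huZ : u ∈ Z
    · simp [huZ]
    rcases Finset.mem_union.1 hv with hv | hv
    · have := hXN v hv u (Finset.mem_sdiff.2 ⟨hu, huZ⟩) hvu
      simp only [Finset.mem_union] at this ⊢
      tauto
    · have := hZN v hv u hu hvu
      simp only [Finset.mem_union] at this ⊢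
      tauto
  by_cases hle : (X ∪ Z).card ≤ s
  · have := hmax (X ∪ Z) ⟨hle, _, hN', hnb⟩
    omega
  · exact hbig _ _ (by omega) (by omega) hN' hnb

/-- A longest path to `r` in an expanding set misses fewer than `s` vertices, and rotations give it
many ends. -/
lemma IsJoined.exists_ends_of_longest [DecidableEq V] {s : ℕ} (hG : G.IsJoined s)
    (hexp : ∀ X N : Finset V, X ⊆ W → X.Nonempty → X.card ≤ s →
      (∀ v ∈ X, ∀ u ∈ W, G.Adj v u → u ∈ X ∪ N) → 3 * X.card < N.card)
    (hl : G.IsListPath W r l) (hmax : ∀ l', G.IsListPath W r l' → l'.length ≤ l.length) :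
    ∃ S : Finset V, s ≤ S.card ∧ W.card < s + 3 * S.card ∧ W.card < s + l.length ∧ S ⊆ W ∧
      ∀ v ∈ S, ∃ l', G.IsListPath W r l' ∧ l'.Perm l ∧ l'.head? = some v := by
  obtain ⟨S, hne, hends, hSl, hadj, N, hN, hSN⟩ := exists_rotation_ends hl hmax
  have hSW : S ⊆ W := fun v hv => hl.mem v (List.mem_toFinset.1 (hSl hv))
  have hsS : s ≤ S.card := by
    by_contra! h
    have := hexp S N hSW hne h.le hSN
    omega
  have hmiss : ∀ T : Finset V, S ⊆ T → (∀ v ∈ S, ∀ u ∈ W, G.Adj v u → u ∈ T) →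
      W.card < s + T.card := by
    intro T hST hT
    by_contra! h
    obtain ⟨a, ha, b, hb, hab⟩ := hG S (W \ T)
      (Finset.disjoint_left.2 fun x hx hx' => (Finset.mem_sdiff.1 hx').2 (hST hx)) hsS (by
        have := Finset.le_card_sdiff T W
        omega)
    exact (Finset.mem_sdiff.1 hb).2 (hT a ha b (Finset.mem_sdiff.1 hb).1 hab)
  refine ⟨S, hsS, ?_, ?_, hSW, hends⟩
  · have := hmiss (S ∪ N) Finset.subset_union_left hSN
    have := Finset.card_union_le S N
    omega
  · have := hmiss l.toFinset hSl hadj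
    rwa [List.toFinset_card_of_nodup hl.nodup] at this

lemma exists_longest_listPath (hr : r ∈ W) :
    ∃ l, G.IsListPath W r l ∧ ∀ l', G.IsListPath W r l' → l'.length ≤ l.length := by
  classical
  have hb : ∀ l, G.IsListPath W r l → l.length ≤ W.card := fun l hl => by
    rw [← List.toFinset_card_of_nodup hl.nodup]
    exact Finset.card_le_card fun x hx => hl.mem x (List.mem_toFinset.1 hx)
  let P : ℕ → Prop := fun m => ∃ l, G.IsListPath W r l ∧ l.length = m
  have h1 : P 1 := ⟨[r], ⟨by simp, by simp, by simp, by simpa using hr⟩, rfl⟩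
  obtain ⟨l, hl, hlen⟩ : P (Nat.findGreatest P W.card) :=
    Nat.findGreatest_spec (Finset.card_pos.2 ⟨r, hr⟩) h1
  refine ⟨l, hl, fun l' hl' => ?_⟩
  rw [hlen]
  exact Nat.le_findGreatest (hb l' hl') ⟨l', hl', rfl⟩

/-! ### Paths with a prescribed number of vertices -/

/-- Paths to `r` of every large enough number of vertices `m`, with at least `s` ends. -/
lemma IsJoined.exists_ends_of_length [DecidableEq V] {s m : ℕ} (hG : G.IsJoined s) {K : Finset V}
    (hKW : K ⊆ W)
    (hexp : ∀ X N : Finset V, X ⊆ W → X.Nonempty → X.card ≤ s →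
      (∀ v ∈ X, ∀ u ∈ K, G.Adj v u → u ∈ X ∪ N) → 3 * X.card < N.card)
    (hr : r ∈ W) (hm : 1 ≤ m) (hKm : s + 3 * K.card ≤ m) (hmW : m + s ≤ W.card + 1) :
    ∃ S : Finset V, s ≤ S.card ∧ S ⊆ W ∧
      ∀ v ∈ S, ∃ l, G.IsListPath W r l ∧ l.length = m ∧ l.head? = some v := by
  classical
  have hexp' : ∀ W' ⊆ W, K ⊆ W' → ∀ X N : Finset V, X ⊆ W' → X.Nonempty → X.card ≤ s →
      (∀ v ∈ X, ∀ u ∈ W', G.Adj v u → u ∈ X ∪ N) → 3 * X.card < N.card :=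
    fun W' hW' hK X N hX hne hc h =>
      hexp X N (hX.trans hW') hne hc fun v hv u hu => h v hv u (hK hu)
  let F := W.powerset.filter fun W' => K ⊆ W' ∧ ∃ l, G.IsListPath W' r l ∧ m ≤ l.length
  have hF : F.Nonempty := by
    obtain ⟨l, hl, hmax⟩ := exists_longest_listPath (G := G) hr
    obtain ⟨S, -, -, h, -⟩ := hG.exists_ends_of_longest (hexp' W subset_rfl hKW) hl hmax
    exact ⟨W, by simp only [F, Finset.mem_filter, Finset.mem_powerset, subset_rfl, true_and]
                 exact ⟨hKW, l, hl, by omega⟩⟩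
  obtain ⟨W', hW', hmin⟩ := Finset.exists_min_image F Finset.card hF
  simp only [F, Finset.mem_filter, Finset.mem_powerset] at hW' hmin
  obtain ⟨hW'W, hKW', l₀, hl₀, hml₀⟩ := hW'
  have hr' : r ∈ W' := hl₀.mem r (List.mem_of_getLast? hl₀.last)
  obtain ⟨l, hl, hmax⟩ := exists_longest_listPath (G := G) hr'
  obtain ⟨S, hsS, hS3, hlen, hSW', hends⟩ :=
    hG.exists_ends_of_longest (hexp' W' hW'W hKW') hl hmax
  have hml : m ≤ l.length := hml₀.trans (hmax l₀ hl₀)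
  have hlW' : l.length ≤ W'.card := by
    rw [← List.toFinset_card_of_nodup hl.nodup]
    exact Finset.card_le_card fun x hx => hl.mem x (List.mem_toFinset.1 hx)
  have heq : l.length = m := by
    by_contra hne
    -- Since `s + 3 * |K| ≤ m < |W'| < s + 3 * |S|`, some end avoids `K`; deleting it from `W'`
    -- contradicts minimality.
    obtain ⟨v, hvS, hvK⟩ : ∃ v ∈ S, v ∉ K := by
      by_contra! h
      have := Finset.card_le_card (show S ⊆ K from h)
      omega
    obtain ⟨l', hl', hperm', hhead⟩ := hends v hvS
    have hlen' := hperm'.length_eq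
    cases l' with
    | nil => simp at hhead
    | cons w t =>
      simp at hhead
      subst hhead
      have hnd := List.nodup_cons.1 hl'.nodup
      simp only [List.length_cons] at hlen'
      have ht : t ≠ [] := by
        rintro rfl
        simp at hlen'
        omega
      have hpath : G.IsListPath (W'.erase w) r t := by
        refine ⟨hl'.chain.tail, hnd.2, ?_, fun x hx => ?_⟩
        · have := hl'.last
          rwa [List.getLast?_cons_of_ne_nil ht] at this
        · refine Finset.mem_erase.2 ⟨?_, hl'.mem x (List.mem_cons_of_mem _ hx)⟩
          rintro rfl
          exact hnd.1 hx
      have := hmin (W'.erase w) ⟨(Finset.erase_subset _ _).trans hW'W,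
        fun x hx => Finset.mem_erase.2 ⟨fun h => hvK (h ▸ hx), hKW' hx⟩, t, hpath, by omega⟩
      have := Finset.card_erase_lt_of_mem (hSW' hvS)
      omega
  refine ⟨S, hsS, hSW'.trans hW'W, fun v hv => ?_⟩
  obtain ⟨l', hl', h1, h2⟩ := hends v hv
  exact ⟨l', ⟨hl'.chain, hl'.nodup, hl'.last, fun x hx => hW'W (hl'.mem x hx)⟩,
    h1.length_eq.trans heq, h2⟩

/-! ### Closing the cycle -/

lemma exists_isCycle_of_list {k : ℕ} (hk : 3 ≤ k) (hchain : l.IsChain G.Adj) (hnd : l.Nodup)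
    (hlen : l.length = k) {v w : V} (hv : l.head? = some v) (hw : l.getLast? = some w)
    (hvw : G.Adj w v) : ∃ (u : V) (c : G.Walk u u), c.IsCycle ∧ c.length = k := by
  have hne : l ≠ [] := by rintro rfl; simp at hv
  have e1 : l.head hne = v := by
    rw [List.head?_eq_some_head hne] at hv
    simpa using hv
  have e2 : l.getLast hne = w := by
    rw [List.getLast?_eq_some_getLast hne] at hw
    simpa using hw
  let p := Walk.ofSupport l hne hchain
  have hadj : G.Adj (l.getLast hne) (l.head hne) := by rw [e1, e2]; exact hvw
  have hpl : p.length = l.length - 1 := Walk.length_ofSupport hne hchain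
  refine ⟨_, Walk.cons hadj p, ?_, ?_⟩
  · rw [Walk.isCycle_iff_isPath_tail_and_le_length]
    refine ⟨?_, ?_⟩
    · rw [Walk.isPath_def, Walk.support_tail_of_not_nil _ Walk.not_nil_cons, Walk.support_cons,
        List.tail_cons, Walk.support_ofSupport]
      exact hnd
    · rw [Walk.length_cons]; omega
  · rw [Walk.length_cons]; omega

/-- The first path uses at most `9 * s` vertices, so the second needs at least `31 * s`, above the
threshold `s + 3 * (9 * s)` for trimming. -/
theorem IsJoined.exists_isCycle [Fintype V] {s k : ℕ} (hG : G.IsJoined s) (hs : 1 ≤ s)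
    (hsk : 40 * s ≤ k) (hkn : k + 2 * s ≤ Fintype.card V + 2) :
    ∃ (v : V) (c : G.Walk v v), c.IsCycle ∧ c.length = k := by
  classical
  obtain ⟨K₁, -, hK₁⟩ := Finset.exists_subset_card_eq (s := (Finset.univ : Finset V))
    (n := 9 * s) (by rw [Finset.card_univ]; omega)
  obtain ⟨K₂, hK₂₁, hK₂⟩ := Finset.exists_subset_card_eq (s := K₁ᶜ)
    (n := 9 * s) (by rw [Finset.card_compl]; omega)
  obtain ⟨Z₁, hZ₁, hexp₁⟩ := hG.exists_expanding hs hK₁.ge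
  obtain ⟨Z₂, hZ₂, hexp₂⟩ := hG.exists_expanding hs hK₂.ge
  obtain ⟨r₁, hr₁, r₂, hr₂, hr⟩ := hG (K₁ \ (Z₁ ∪ Z₂)) (K₁ᶜ \ Z₂)
    (Finset.disjoint_left.2 fun x hx hx' =>
      Finset.mem_compl.1 (Finset.mem_sdiff.1 hx').1 (Finset.mem_sdiff.1 hx).1)
    (by
      have := Finset.le_card_sdiff (Z₁ ∪ Z₂) K₁
      have := Finset.card_union_le Z₁ Z₂
      omega)
    (by
      have := Finset.le_card_sdiff Z₂ K₁ᶜ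
      rw [Finset.card_compl] at this
      omega)
  simp only [Finset.mem_sdiff, Finset.mem_union, Finset.mem_compl, not_or] at hr₁ hr₂
  obtain ⟨l₁, hl₁, hmax₁⟩ := exists_longest_listPath (G := G) (W := K₁ \ Z₁) (r := r₁)
    (Finset.mem_sdiff.2 ⟨hr₁.1, hr₁.2.1⟩)
  obtain ⟨S₁, hS₁, -, -, -, hends₁⟩ := hG.exists_ends_of_longest
    (fun X N hX hne hc h => hexp₁ X N
      (Finset.disjoint_left.2 fun x hx hx' => (Finset.mem_sdiff.1 (hX hx)).2 hx') hne hc h)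
    hl₁ hmax₁
  have hl₁K : l₁.toFinset ⊆ K₁ := fun x hx =>
    (Finset.mem_sdiff.1 (hl₁.mem x (List.mem_toFinset.1 hx))).1
  have hcard₁ := List.toFinset_card_of_nodup hl₁.nodup
  have hlen₁ := Finset.card_le_card hl₁K
  obtain ⟨S₂, hS₂, hS₂W, hends₂⟩ := hG.exists_ends_of_length (W := (l₁.toFinset ∪ Z₂)ᶜ)
    (r := r₂) (K := K₂ \ Z₂) (m := k - l₁.length)
    (fun x hx => by
      rw [Finset.mem_sdiff] at hx
      rw [Finset.mem_compl, Finset.mem_union, not_or]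
      exact ⟨fun h => Finset.mem_compl.1 (hK₂₁ hx.1) (hl₁K h), hx.2⟩)
    (fun X N hX hne hc h => hexp₂ X N
      (Finset.disjoint_left.2 fun x hx hx' =>
        Finset.mem_compl.1 (hX hx) (Finset.mem_union_right _ hx')) hne hc h)
    (by
      rw [Finset.mem_compl, Finset.mem_union, not_or]
      exact ⟨fun h => hr₂.1 (hl₁K h), hr₂.2⟩)
    (by omega)
    (by
      have := Finset.card_le_card (Finset.sdiff_subset : K₂ \ Z₂ ⊆ K₂)
      omega)
    (by
      have := Finset.card_union_le l₁.toFinset Z₂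
      rw [Finset.card_compl]
      omega)
  have hS₁l : ∀ v ∈ S₁, v ∈ l₁.toFinset := fun v hv => by
    obtain ⟨l, -, hperm, hhead⟩ := hends₁ v hv
    exact List.mem_toFinset.2 (hperm.mem_iff.1 (List.mem_of_head? hhead))
  obtain ⟨v₁, hv₁, v₂, hv₂, hv⟩ := hG S₁ S₂ (Finset.disjoint_left.2 fun x hx hx' =>
    Finset.mem_compl.1 (hS₂W hx') (Finset.mem_union_left _ (hS₁l x hx))) hS₁ hS₂
  obtain ⟨p, hp, hpl, hpv⟩ := hends₁ v₁ hv₁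
  obtain ⟨q, hq, hql, hqv⟩ := hends₂ v₂ hv₂
  have hplen := hpl.length_eq
  have hq₀ : q ≠ [] := by rintro rfl; simp at hqv
  have hp₀ : p.reverse ≠ [] := by
    rw [Ne, List.reverse_eq_nil_iff]
    rintro rfl
    simp at hpv
  refine exists_isCycle_of_list (l := p.reverse ++ q) (v := r₁) (w := r₂)
    (by omega) ?_ ?_ ?_ ?_ ?_ hr.symm
  · refine List.isChain_append.2 ⟨List.isChain_reverse.2 (hp.chain.imp fun _ _ h => h.symm),
      hq.chain, fun x hx y hy => ?_⟩
    rw [List.getLast?_reverse, hpv, Option.mem_some_iff] at hx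
    rw [hqv, Option.mem_some_iff] at hy
    exact hx ▸ hy ▸ hv
  · refine List.nodup_append'.2 ⟨List.nodup_reverse.2 hp.nodup, hq.nodup, fun x hx hx' => ?_⟩
    exact Finset.mem_compl.1 (hq.mem x hx') (Finset.mem_union_left _
      (List.mem_toFinset.2 (hpl.mem_iff.1 (List.mem_reverse.1 hx))))
  · rw [List.length_append, List.length_reverse]
    omega
  · rw [List.head?_append_of_ne_nil _ hp₀, List.head?_reverse, hp.last]
  · rw [List.getLast?_append_of_ne_nil _ hq₀, hq.last]

end SimpleGraph

/-! ### From `n` and `t` to the integer `s` -/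

theorem theorem4 :
    ∃ n₀ : ℕ, ∀ n : ℕ, n₀ ≤ n →
      ∀ (V : Type*) [Fintype V], Fintype.card V = n →
      ∀ (G : SimpleGraph V) (t : ℝ), 2 ≤ t →
        (∀ A B : Finset V, Disjoint A B →
          (n : ℝ) / t ≤ (A.card : ℝ) → (n : ℝ) / t ≤ (B.card : ℝ) →
          ∃ a ∈ A, ∃ b ∈ B, G.Adj a b) →
        ∀ k : ℕ, 3 ≤ k →
          8 * (n : ℝ) * Real.log (n : ℝ) / (t * Real.log (Real.log (n : ℝ))) ≤ (k : ℝ) →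
          (k : ℝ) ≤ (n : ℝ) - 3 * (n : ℝ) / t →
          ∃ (v : V) (c : G.Walk v v), c.IsCycle ∧ c.length = k := by
  have hlog : Filter.Tendsto (fun n : ℕ => Real.log (n : ℝ)) Filter.atTop Filter.atTop :=
    Real.tendsto_log_atTop.comp tendsto_natCast_atTop_atTop
  have hev : ∀ᶠ x : ℝ in Filter.atTop, 0 < Real.log x ∧ 10 * Real.log x ≤ x := by
    filter_upwards [Real.isLittleO_log_id_atTop.bound (show (0 : ℝ) < 1 / 10 by norm_num),
      Filter.eventually_gt_atTop 1] with x hx hx1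
    have hpos := Real.log_pos hx1
    rw [Real.norm_of_nonneg hpos.le, id, Real.norm_of_nonneg (by linarith)] at hx
    exact ⟨hpos, by linarith⟩
  obtain ⟨n₀, hn₀⟩ := Filter.eventually_atTop.1 (hlog.eventually hev)
  refine ⟨max n₀ 1, fun n hn V _ hV G t ht hG k hk hlow hup => ?_⟩
  obtain ⟨hpos, hlarge⟩ := hn₀ n ((le_max_left _ _).trans hn)
  have hn1 : (1 : ℝ) ≤ n := by exact_mod_cast (le_max_right _ _).trans hn
  have ht0 : 0 < t := by linarith
  set x : ℝ := n / t with hx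
  have hx0 : 0 < x := by positivity
  have hjoin : G.IsJoined ⌈x⌉₊ := fun A B hAB hA hB =>
    hG A B hAB (Nat.ceil_le.1 hA) (Nat.ceil_le.1 hB)
  have hup' : (k : ℝ) ≤ n - 3 * x := by rwa [hx, ← mul_div_assoc]
  -- For `x < 1` the ceiling is not bounded by `2 * x`, but then single vertices are joined and the
  -- graph is complete.
  rcases lt_or_ge x 1 with h1 | h1
  · have hcomplete : ∀ a b : V, a ≠ b → G.Adj a b := fun a b hab => by
      obtain ⟨a', ha, b', hb, h⟩ := hG {a} {b} (by simpa using hab) (by simpa using h1.le)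
        (by simpa using h1.le)
      rw [Finset.mem_singleton] at ha hb
      exact ha ▸ hb ▸ h
    have hkn : k ≤ n := by
      have : (k : ℝ) ≤ n := by linarith
      exact_mod_cast this
    obtain ⟨A, -, hA⟩ := Finset.exists_subset_card_eq (s := (Finset.univ : Finset V)) (n := k)
      (by rw [Finset.card_univ, hV]; exact hkn)
    have hne : A.toList ≠ [] := by
      rw [Ne, Finset.toList_eq_nil]
      rintro rfl
      simp at hA
      omega
    have hnd := A.nodup_toList
    refine SimpleGraph.exists_isCycle_of_list hk
      ((List.Pairwise.imp (fun h => hcomplete _ _ h) hnd).isChain) hnd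
      (by rw [Finset.length_toList, hA]) (List.head?_eq_some_head hne)
      (List.getLast?_eq_some_getLast hne) (hcomplete _ _ fun h => ?_)
    rw [List.getLast_eq_getElem, List.head_eq_getElem, hnd.getElem_inj_iff,
      Finset.length_toList] at h
    omega
  · have hceil := Nat.ceil_lt_add_one hx0.le
    have hceil1 : 1 ≤ ⌈x⌉₊ := Nat.one_le_ceil_iff.2 hx0
    refine hjoin.exists_isCycle hceil1 ?_ ?_
    · have h2 : 80 * x ≤ k := by
        refine le_trans ?_ hlow
        rw [hx, le_div_iff₀ (by positivity)]
        have : 80 * (n / t) * (t * Real.log (Real.log n)) = 8 * n * (10 * Real.log (Real.log n)) := by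
          field_simp
          ring
        rw [this]
        gcongr
      have : ((40 * ⌈x⌉₊ : ℕ) : ℝ) ≤ k := by
        push_cast
        linarith
      exact_mod_cast this
    · have h3 : ((k + 3 * ⌈x⌉₊ : ℕ) : ℝ) < ((n + 3 : ℕ) : ℝ) := by
        push_cast
        linarith
      have h4 : k + 3 * ⌈x⌉₊ < n + 3 := by exact_mod_cast h3
      omega
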